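/- Let $\kappa\in\mathbb{R}$, $\mathfrak{st}_\kappa^d=\{x\in\mathbb{R}^d : -\kappa\|x\|^2<1\}$, $\lambda_x^\kappa=\frac{2}{1+\kappa\|x\|^2}$, and $$x\oplus_\kappa y=\frac{(1-2\kappa\langle x,y\rangle-\kappa\|y\|^2)x+(1+\kappa\|x\|^2)y}{1-2\kappa\langle x,y\rangle+\kappa^2\|x\|^2\|y\|^2}$$ whenever the denominator is nonzero. Put $\tau_\kappa(u)=\tan(\sqrt\kappa\,u)/\sqrt\kappa$, $u$, $\tanh(\sqrt{-\kappa}\,u)/\sqrt{-\kappa}$ for $\kappa>0$, $\kappa=0$, $\kappa<0$ respectively, let $\tau_\kappa^{-1}$ be its principal inverse, and let $r\otimes_\kappa x=\tau_\kappa(r\,\tau_\kappa^{-1}(\|x\|))\frac{x}{\|x\|}$ (with $r\otimes_\kappa 0=0$) and $d_\kappa(x,y)=2\,\tau_\kappa^{-1}(\|(-x)\oplus_\kappa y\|)$ (with value $\pi/\sqrt\kappa$ when $(-x)\oplus_\kappa y$ is undefined). For $x_1,\dots,x_n\in\mathfrak{st}_\kappa^d$ and weights $\alpha\in\mathbb{R}^n$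 let $T(x;\alpha)=\sum_j\alpha_j(\lambda_{x_j}^\kappa-1)$ and let $$m_\kappa(x_1,\dots,x_n;\alpha)=\tfrac12\otimes_\kappa\Big(\sum_i\frac{\alpha_i\lambda^\kappa_{x_i}}{T(x;\alpha)}\,x_i\Big)$$ be the weighted gyromidpoint, called defined if $T(x;\alpha)\neq0$ and the point in the large parentheses lies in $\mathfrak{st}_\kappa^d$. For $A\in\mathbb{R}^{n\times n}$ and $X\in\mathbb{R}^{n\times d}$ with rows $X_j\in\mathfrak{st}_\kappa^d$ let $(A\boxtimes_\kappa X)_i=\big(\sum_jA_{ij}\big)\otimes_\kappa m_\kappa(X_1,\dots,X_n;A_{i\bullet})$. Theorem. Suppose that every row of $A$ sums to $1$ (in particular, $A$ may be any right-stochastic matrix), and let $X$ have its rows in $\mathfrak{st}_\kappa^d$. 1. If $\kappa\le0$ and the entries of $A$ are non-negative, then $m_\kappa(X;A_{i\bullet})$ is defined for all $i$. In 2–6 let $i$ be such that $m_\kappa(X;A_{i\bullet})$ is defined. 2. $(A\boxtimes_\kappa X)_i=m_\kappa(X_1,\dots,X_n;A_{i\bullet})\in\mathfrak{st}_\kappa^d$.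 3. For every isometry $\phi$ of $(\mathfrak{st}_\kappa^d,d_\kappa)$ (distance-preserving self-map), with $\phi(X)$ the matrix with rows $\phi(X_j)$, the midpoint $m_\kappa(\phi(X);A_{i\bullet})$ is defined and $(A\boxtimes_\kappa\phi(X))_i=\phi((A\boxtimes_\kappa X)_i)$. 4. Let $\phi(x)=z\oplus_\kappa Rx$ with $z\in\mathfrak{st}_\kappa^d$, $R\in O(d)$. If $\kappa>0$, assume in addition that $\phi$ is defined at all rows of $X$ and that $T(X;A_{i\bullet})$ and $T(\phi(X);A_{i\bullet})$ are nonzero and of the same sign. Then $m_\kappa(\phi(X);A_{i\bullet})$ is defined, $\phi$ is defined at $(A\boxtimes_\kappa X)_i$, and $(A\boxtimes_\kappa\phi(X))_i=\phi((A\boxtimes_\kappa X)_i)$. In 5 and 6 let $B\in\mathbb{R}^{m\times m}$ have all row sums equal to $1$, let $Y\in\mathbb{R}^{m\times d}$ have its rows in $\mathfrak{st}_\kappa^d$, and let $k$ be such that $m_\kappa(Y;B_{k\bullet})$ is defined. 5. For every isometry $\phi$ of $(\mathfrak{st}_\kappa^d,d_\kappa)$, $$d_\kappa\big((A\boxtimes_\kappa\phi(X))_i,(B\boxtimes_\kappa\phi(Y))_k\big)=d_\kappa\big((A\boxtimes_\kappa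 X)_i,(B\boxtimes_\kappa Y)_k\big).$$ 6. Let $X'\in\mathbb{R}^{n\times d}$ and $Y'\in\mathbb{R}^{m\times d}$ have rows in $\mathfrak{st}_\kappa^d$ with the same mutual distances as the rows of $X$ and $Y$: $d_\kappa(X'_j,X'_l)=d_\kappa(X_j,X_l)$, $d_\kappa(Y'_j,Y'_l)=d_\kappa(Y_j,Y_l)$ and $d_\kappa(X'_j,Y'_l)=d_\kappa(X_j,Y_l)$ for all indices. If $\kappa>0$, assume in addition that $T(X;A_{i\bullet})$ and $T(X';A_{i\bullet})$ are nonzero and of the same sign, and likewise $T(Y;B_{k\bullet})$ and $T(Y';B_{k\bullet})$. Then $m_\kappa(X';A_{i\bullet})$ and $m_\kappa(Y';B_{k\bullet})$ are defined and $d_\kappa\big((A\boxtimes_\kappa X')_i,(B\boxtimes_\kappa Y')_k\big)=d_\kappa\big((A\boxtimes_\kappa X)_i,(B\boxtimes_\kappa Y)_k\big)$. -/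

import Mathlib

noncomputable section

namespace KappaStereo

/-- The coordinate space `ℝ^d` with its Euclidean norm. -/
abbrev E (d : ℕ) : Type := EuclideanSpace ℝ (Fin d)

/-- The underlying set of the `κ`-stereographic model: `{x ∈ ℝ^d | -κ‖x‖² < 1}`. It is an open ball
for `κ < 0` and all of `ℝ^d` for `κ ≥ 0`. -/
def st (κ : ℝ) (d : ℕ) : Set (E d) := {x | -κ * ‖x‖ ^ 2 < 1}

/-- The conformal factor `λ_x = 2 / (1 + κ‖x‖²)`. -/
def conf {d : ℕ} (κ : ℝ) (x : E d) : ℝ := 2 / (1 + κ * ‖x‖ ^ 2)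

/-- The denominator of the `κ`-addition; `x ⊕ y` is defined exactly when it is nonzero. -/
def addDen {d : ℕ} (κ : ℝ) (x y : E d) : ℝ :=
  1 - 2 * κ * inner ℝ x y + κ ^ 2 * ‖x‖ ^ 2 * ‖y‖ ^ 2

/-- The `κ`-addition `x ⊕ y`. -/
def kAdd {d : ℕ} (κ : ℝ) (x y : E d) : E d :=
  (addDen κ x y)⁻¹ •
    ((1 - 2 * κ * inner ℝ x y - κ * ‖y‖ ^ 2) • x + (1 + κ * ‖x‖ ^ 2) • y)

/-- `tan_κ (|κ|^{1/2} u)`, with its limit value `u` at `κ = 0`. -/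
def tanK (κ u : ℝ) : ℝ :=
  if 0 < κ then Real.tan (√κ * u) / √κ
  else if κ < 0 then Real.tanh (√(-κ) * u) / √(-κ)
  else u

/-- `|κ|^{-1/2} tan_κ⁻¹ u`, with its limit value `u` at `κ = 0`. -/
def arctanK (κ u : ℝ) : ℝ :=
  if 0 < κ then Real.arctan (√κ * u) / √κ
  else if κ < 0 then Real.artanh (√(-κ) * u) / √(-κ)
  else u

/-- The distance `d_κ(x, y) = 2 |κ|^{-1/2} tan_κ⁻¹ ‖(-x) ⊕ y‖`. When `(-x) ⊕ y` is undefined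
(only if `κ > 0` and `x`, `y` are images of antipodal points of the sphere of radius `1/√κ`), the
distance is the limit value `π/√κ`. -/
def kDist {d : ℕ} (κ : ℝ) (x y : E d) : ℝ :=
  if addDen κ (-x) y = 0 then Real.pi / √κ
  else 2 * arctanK κ ‖kAdd κ (-x) y‖

/-- The `κ`-scaling `r ⊗ x = tan_κ (r tan_κ⁻¹ ‖x‖) x / ‖x‖`, with `r ⊗ 0 = 0`. -/
def kSmul {d : ℕ} (κ r : ℝ) (x : E d) : E d :=
  (tanK κ (r * arctanK κ ‖x‖) / ‖x‖) • x

/-- The denominator `∑ j, α_j (λ_{x_j} - 1)` of the gyromidpoint. -/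
def midDen {d n : ℕ} (κ : ℝ) (α : Fin n → ℝ) (x : Fin n → E d) : ℝ :=
  ∑ j, α j * (conf κ (x j) - 1)

/-- The point `∑ i, (α_i λ_{x_i} / ∑ j, α_j (λ_{x_j} - 1)) x_i`. -/
def midDouble {d n : ℕ} (κ : ℝ) (α : Fin n → ℝ) (x : Fin n → E d) : E d :=
  ∑ i, (α i * conf κ (x i) / midDen κ α x) • x i

/-- The weighted gyromidpoint `m_κ(x_1, …, x_n; α) = 1/2 ⊗ ∑ i, (α_i λ_{x_i} / ∑ j, α_j (λ_{x_j} - 1)) x_i`. -/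
def gyromidpoint {d n : ℕ} (κ : ℝ) (α : Fin n → ℝ) (x : Fin n → E d) : E d :=
  kSmul κ (1 / 2) (midDouble κ α x)

/-- The formula for the gyromidpoint makes sense: its denominator is nonzero and the scaling
`1/2 ⊗ ·` is applied to a point of the model. -/
def MidDefined {d n : ℕ} (κ : ℝ) (α : Fin n → ℝ) (x : Fin n → E d) : Prop :=
  midDen κ α x ≠ 0 ∧ midDouble κ α x ∈ st κ d

/-- The `κ`-left-matrix-multiplication `A ⊠ X`, given row by row by
`(A ⊠ X)_i = (∑ j, A_{ij}) ⊗ m_κ(X_1, …, X_n; A_i)`; `X j` is the `j`-th row of `X`. -/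
def leftMul {d n : ℕ} (κ : ℝ) (A : Matrix (Fin n) (Fin n) ℝ) (X : Fin n → E d) : Fin n → E d :=
  fun i => kSmul κ (∑ j, A i j) (gyromidpoint κ (A i) X)

/-- All row sums are `1`. Non-negativity of the entries is not required here. -/
def RowSumsOne {n : ℕ} (A : Matrix (Fin n) (Fin n) ℝ) : Prop := ∀ i, ∑ j, A i j = 1

/-- `φ` is an isometry of the metric space `(st_κ^d, d_κ)`: it maps the model to itself and preserves
distances (its values outside the model are irrelevant). -/
def IsIsom {d : ℕ} (κ : ℝ) (φ : E d → E d) : Prop :=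
  Set.MapsTo φ (st κ d) (st κ d) ∧
    ∀ x ∈ st κ d, ∀ y ∈ st κ d, kDist κ (φ x) (φ y) = kDist κ x y

end KappaStereo

end

open KappaStereo

noncomputable section

namespace KappaStereo

variable {d n m : ℕ} {κ : ℝ}

/-! The map `lift` is inverse stereographic projection from `(-1, 0)` onto the quadric `t² + κ‖v‖² =
1`, and the claims become linear algebra for `form`. The weighted sum `s = liftSum κ α x` has first
coordinate `midDen`; `midDouble` is `s.2 / s.1`, its gnomonic (Beltrami–Klein) image, and `1/2 ⊗`
converts that to stereographic coordinates. So the midpoint is defined iff `s.1 ≠ 0` and `form s s >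
0`, and then `s = c • lift m`, where `m` is the unique such point with positive first coordinate
(`gyromidpoint_spec`, `midDefined_of_liftSum_eq`).

For `κ ≠ 0`, equal distances mean equal values of `form` on lifts (`kDist_eq_iff`). By bilinearity,
congruent systems have equal pairings of their sums; once the sign of `c` is controlled, distances
between midpoints agree (`kDist_gyromidpoint_eq`). For `κ = 0` midpoints are affine combinations,
and a polarisation identity replaces this. Commutation with isometries follows by adjoining the
midpoint itself as a one-point system.

For `κ > 0` the sign condition is automatic for isometries: they fix the origin, because the sphere
lacks exactly the antipode of the origin (`isom_zero`). Motions are treated separately: `z ⊕ R x` is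
linear on lifts (`lift_kAdd`), so it carries `s` along. -/

theorem mem_st {x : E d} : x ∈ st κ d ↔ 0 < 1 + κ * ‖x‖ ^ 2 := by
  simp only [st, Set.mem_ofPred_eq]
  constructor <;> intro h <;> linarith

theorem neg_mem_st {x : E d} (hx : x ∈ st κ d) : -x ∈ st κ d := by
  rw [mem_st] at *
  simpa using hx

theorem conf_pos {x : E d} (hx : x ∈ st κ d) : 0 < conf κ x :=
  div_pos two_pos (mem_st.1 hx)

theorem conf_mul_cancel {x : E d} (hx : x ∈ st κ d) : conf κ x * (1 + κ * ‖x‖ ^ 2) = 2 :=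
  div_mul_cancel₀ _ (mem_st.1 hx).ne'

@[simp]
theorem conf_neg (x : E d) : conf κ (-x) = conf κ x := by simp [conf]

theorem mul_norm_sq_eq {x : E d} (hx : x ∈ st κ d) : κ * ‖x‖ ^ 2 = 2 / conf κ x - 1 := by
  have h := conf_mul_cancel hx
  have h0 := (conf_pos hx).ne'
  field_simp
  linarith

/-- The embedding of the model into the quadric `t² + κ‖v‖² = 1`. -/
def lift (κ : ℝ) (x : E d) : ℝ × E d := (conf κ x - 1, conf κ x • x)

/-- The symmetric bilinear form `t t' + κ⟨v, v'⟩`. -/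
def form (κ : ℝ) : (ℝ × E d) →ₗ[ℝ] (ℝ × E d) →ₗ[ℝ] ℝ :=
  LinearMap.mk₂ ℝ (fun p q => p.1 * q.1 + κ * inner ℝ p.2 q.2)
    (fun p p' q => by simp [inner_add_left]; ring)
    (fun c p q => by simp [real_inner_smul_left]; ring)
    (fun p q q' => by simp [inner_add_right]; ring)
    (fun c p q => by simp [real_inner_smul_right]; ring)

theorem form_apply (p q : ℝ × E d) : form κ p q = p.1 * q.1 + κ * inner ℝ p.2 q.2 := rfl

theorem form_self (p : ℝ × E d) : form κ p p = p.1 ^ 2 + κ * ‖p.2‖ ^ 2 := by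
  rw [form_apply, real_inner_self_eq_norm_sq]; ring

theorem form_comm (p q : ℝ × E d) : form κ p q = form κ q p := by
  rw [form_apply, form_apply, real_inner_comm]; ring

theorem form_lift_lift (x y : E d) : form κ (lift κ x) (lift κ y) =
    (conf κ x - 1) * (conf κ y - 1) + κ * (conf κ x * conf κ y * inner ℝ x y) := by
  simp only [form_apply, lift, real_inner_smul_left, real_inner_smul_right]
  ring

theorem form_lift_self {x : E d} (hx : x ∈ st κ d) : form κ (lift κ x) (lift κ x) = 1 := by
  rw [form_lift_lift, real_inner_self_eq_norm_sq]
  linear_combination conf κ x * conf_mul_cancel hx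

theorem lift_injOn : Set.InjOn (lift κ) (st κ d) := by
  intro x hx y hy h
  have h1 : conf κ x = conf κ y := by
    have := congrArg Prod.fst h
    simpa [lift] using this
  have h2 : conf κ x • x = conf κ y • y := congrArg Prod.snd h
  rw [h1] at h2
  exact smul_right_injective _ (conf_pos hy).ne' h2

/-- A point of the quadric other than `(-1, 0)` comes from the model, if it lies on the sheet
`t > -1`. -/
theorem exists_lift_eq {p : ℝ × E d} (hp : form κ p p = 1) (h : -1 < p.1) :
    ∃ x ∈ st κ d, lift κ x = p := by
  obtain ⟨t, v⟩ := p
  rw [form_self] at hp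
  simp only at hp h
  have h1 : 0 < 1 + t := by linarith
  have hn : 1 + κ * ‖(1 + t)⁻¹ • v‖ ^ 2 = 2 / (1 + t) := by
    rw [norm_smul, mul_pow, Real.norm_eq_abs, sq_abs]
    field_simp
    linear_combination hp
  refine ⟨(1 + t)⁻¹ • v, ?_, ?_⟩
  · rw [mem_st, hn]; positivity
  · have hc : conf κ ((1 + t)⁻¹ • v) = 1 + t := by
      rw [conf, hn]; field_simp
    simp [lift, hc, h1.ne']

/-- The squared chord between two lifts, measured by `form`; it yields the reversed Cauchy–Schwarz
bound for `κ ≤ 0` and separation of points for `κ ≠ 0`. -/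
theorem one_sub_form_lift {x y : E d} (hx : x ∈ st κ d) (hy : y ∈ st κ d) :
    κ * (conf κ x * conf κ y * ‖x - y‖ ^ 2) = 2 * (1 - form κ (lift κ x) (lift κ y)) := by
  rw [form_lift_lift, norm_sub_sq_real]
  linear_combination conf κ y * conf_mul_cancel hx + conf κ x * conf_mul_cancel hy

theorem one_le_form_lift (hκ : κ ≤ 0) {x y : E d} (hx : x ∈ st κ d) (hy : y ∈ st κ d) :
    1 ≤ form κ (lift κ x) (lift κ y) := by
  have h := one_sub_form_lift hx hy
  have h1 : 0 ≤ conf κ x * conf κ y * ‖x - y‖ ^ 2 :=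
    mul_nonneg (mul_pos (conf_pos hx) (conf_pos hy)).le (sq_nonneg _)
  nlinarith [mul_nonpos_of_nonpos_of_nonneg hκ h1]

theorem eq_of_form_lift_eq_one (hκ : κ ≠ 0) {x y : E d} (hx : x ∈ st κ d) (hy : y ∈ st κ d)
    (h : form κ (lift κ x) (lift κ y) = 1) : x = y := by
  have h1 := one_sub_form_lift hx hy
  rw [h, sub_self, mul_zero] at h1
  have hc := (mul_pos (conf_pos hx) (conf_pos hy)).ne'
  have h2 : ‖x - y‖ ^ 2 = 0 := by
    rcases mul_eq_zero.1 h1 with h1 | h1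
    · exact absurd h1 hκ
    · exact (mul_eq_zero.1 h1).resolve_left hc
  simpa [sub_eq_zero] using h2

theorem one_le_conf_sub_one (hκ : κ < 0) {x : E d} (hx : x ∈ st κ d) : 1 ≤ conf κ x - 1 := by
  have h : (0 : E d) ∈ st κ d := by simp [mem_st]
  simpa [form_lift_lift, conf, show (2 : ℝ) - 1 = 1 by norm_num] using one_le_form_lift hκ.le hx h

/-! ### The `κ`-addition -/

/-- `κ`-addition therefore breaks down exactly when the lifts of `-x` and `y` pair to `-1`, which
for `κ > 0` means antipodal points. -/
theorem addDen_eq {x y : E d} (hx : x ∈ st κ d) (hy : y ∈ st κ d) :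
    addDen κ x y * conf κ x * conf κ y = 2 * (1 + form κ (lift κ (-x)) (lift κ y)) := by
  have h1 := mul_norm_sq_eq hx
  have h2 := mul_norm_sq_eq hy
  have h : addDen κ x y = 1 - 2 * κ * inner ℝ x y + (κ * ‖x‖ ^ 2) * (κ * ‖y‖ ^ 2) := by
    rw [addDen]; ring
  have hx0 := (conf_pos hx).ne'
  have hy0 := (conf_pos hy).ne'
  rw [form_lift_lift, h, h1, h2, conf_neg, inner_neg_left]
  field_simp
  ring

theorem addDen_nonneg (x y : E d) : 0 ≤ addDen κ x y := by
  have h1 : |κ * inner ℝ x y| ≤ |κ| * (‖x‖ * ‖y‖) := by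
    rw [abs_mul]
    exact mul_le_mul_of_nonneg_left (abs_real_inner_le_norm x y) (abs_nonneg κ)
  -- A square plus the Cauchy–Schwarz defect.
  have h2 : addDen κ x y = (1 - |κ| * (‖x‖ * ‖y‖)) ^ 2 +
      2 * (|κ| * (‖x‖ * ‖y‖) - κ * inner ℝ x y) := by
    rw [addDen, ← sq_abs κ]; ring
  rw [h2]
  have := le_abs_self (κ * inner ℝ x y)
  nlinarith [sq_nonneg (1 - |κ| * (‖x‖ * ‖y‖))]

theorem addDen_pos (hκ : κ ≤ 0) {x y : E d} (hx : x ∈ st κ d) (hy : y ∈ st κ d) :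
    0 < addDen κ x y := by
  have h := addDen_eq hx hy
  have h1 := one_le_form_lift hκ (neg_mem_st hx) hy
  have hc := mul_pos (conf_pos hx) (conf_pos hy)
  refine (addDen_nonneg x y).lt_of_ne fun h0 => ?_
  rw [← h0] at h
  linarith

theorem one_add_mul_norm_kAdd_sq {x y : E d} (h : addDen κ x y ≠ 0) :
    1 + κ * ‖kAdd κ x y‖ ^ 2 =
      (1 + κ * ‖x‖ ^ 2) * (1 + κ * ‖y‖ ^ 2) / addDen κ x y := by
  rw [kAdd, norm_smul, mul_pow, Real.norm_eq_abs, sq_abs, norm_add_sq_real, norm_smul, norm_smul,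
    mul_pow, mul_pow, Real.norm_eq_abs, Real.norm_eq_abs, sq_abs, sq_abs, real_inner_smul_left,
    real_inner_smul_right]
  field_simp
  simp only [addDen]
  ring

theorem kAdd_mem_st {x y : E d} (hx : x ∈ st κ d) (hy : y ∈ st κ d) (h : addDen κ x y ≠ 0) :
    kAdd κ x y ∈ st κ d := by
  rw [mem_st] at *
  rw [one_add_mul_norm_kAdd_sq h]
  exact div_pos (mul_pos hx hy) ((addDen_nonneg x y).lt_of_ne' h)

theorem conf_kAdd {x y : E d} (hx : x ∈ st κ d) (hy : y ∈ st κ d) (h : addDen κ x y ≠ 0) :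
    conf κ (kAdd κ x y) = 1 + form κ (lift κ (-x)) (lift κ y) := by
  have h1 := (mem_st.1 hx).ne'
  have h2 := (mem_st.1 hy).ne'
  have h3 := addDen_eq hx hy
  rw [conf, one_add_mul_norm_kAdd_sq h]
  simp only [conf] at h3
  field_simp
  field_simp at h3
  linarith

/-- The linear map of `ℝ × ℝ^d` which is induced by the left translation `z ⊕ ·`. -/
def leftTrans (κ : ℝ) (z : E d) : (ℝ × E d) →ₗ[ℝ] (ℝ × E d) :=
  LinearMap.prod (form κ (lift κ (-z)))
    (LinearMap.snd ℝ ℝ (E d) +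
      LinearMap.smulRight (form κ ((1, -z) : ℝ × E d)) (conf κ z • z))

/-- The conformal factor of `z ⊕ x` cancels the denominator of the addition, leaving an expression
linear in `lift κ x`. -/
theorem lift_kAdd {z x : E d} (hz : z ∈ st κ d) (hx : x ∈ st κ d) (h : addDen κ z x ≠ 0) :
    lift κ (kAdd κ z x) = leftTrans κ z (lift κ x) := by
  have hc := conf_kAdd hz hx h
  refine Prod.ext ?_ ?_
  · simp [lift, leftTrans] at hc ⊢
    linarith
  · have hD := addDen_eq hz hx
    have hcD : conf κ (kAdd κ z x) * (addDen κ z x)⁻¹ = conf κ z * conf κ x / 2 := by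
      field_simp
      linear_combination 2 * hc - hD
    have e : (lift κ (kAdd κ z x)).2 = (conf κ (kAdd κ z x) * (addDen κ z x)⁻¹) •
        ((1 - 2 * κ * inner ℝ z x - κ * ‖x‖ ^ 2) • z + (1 + κ * ‖z‖ ^ 2) • x) := by
      simp only [lift, kAdd, smul_smul]
    have e' : (leftTrans κ z (lift κ x)).2 =
        conf κ x • x + (form κ (1, -z) (lift κ x) * conf κ z) • z := by
      simp [leftTrans, lift, smul_smul]
    rw [e, e', hcD, smul_add, smul_smul, smul_smul, add_comm]
    congr 2
    · linear_combination conf κ x / 2 * conf_mul_cancel hz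
    · simp only [form_apply, lift, inner_neg_left, real_inner_smul_right]
      linear_combination -(conf κ z / 2) * conf_mul_cancel hx

/-- The half-angle formula `1 + tan²(θ/2) = 2 / (1 + cos θ)`, with `form` in the role of the cosine.
-/
theorem mul_norm_neg_kAdd_sq {x y : E d} (hx : x ∈ st κ d) (hy : y ∈ st κ d)
    (h : addDen κ (-x) y ≠ 0) :
    1 + κ * ‖kAdd κ (-x) y‖ ^ 2 = 2 / (1 + form κ (lift κ x) (lift κ y)) := by
  have h1 := conf_kAdd (neg_mem_st hx) hy h
  have h2 := conf_mul_cancel (kAdd_mem_st (neg_mem_st hx) hy h)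
  have h3 := conf_pos (kAdd_mem_st (neg_mem_st hx) hy h)
  rw [neg_neg] at h1
  rw [h1] at h2 h3
  rw [eq_div_iff h3.ne']
  linarith

theorem addDen_neg_eq_zero_iff {x y : E d} (hx : x ∈ st κ d) (hy : y ∈ st κ d) :
    addDen κ (-x) y = 0 ↔ form κ (lift κ x) (lift κ y) = -1 := by
  have h := addDen_eq (neg_mem_st hx) hy
  rw [neg_neg, conf_neg] at h
  have hx0 := (conf_pos hx).ne'
  have hy0 := (conf_pos hy).ne'
  constructor
  · intro h0
    rw [h0] at h
    linarith
  · intro h0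
    rw [h0] at h
    simpa [hx0, hy0] using h

/-! ### The distance -/

theorem kDist_zero_curvature (x y : E d) : kDist 0 x y = 2 * ‖x - y‖ := by
  rw [norm_sub_rev]
  simp [kDist, addDen, kAdd, arctanK, sub_eq_add_neg, add_comm]

theorem cos_kDist (hκ : 0 < κ) {x y : E d} (hx : x ∈ st κ d) (hy : y ∈ st κ d) :
    Real.cos (√κ * kDist κ x y) = form κ (lift κ x) (lift κ y) := by
  have hs : √κ ≠ 0 := (Real.sqrt_pos.2 hκ).ne'
  -- The default distance `π/√κ` has cosine `-1`, which is the value of `form` at antipodes, so no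
  -- exception is needed.
  by_cases h : addDen κ (-x) y = 0
  · rw [kDist, if_pos h, (addDen_neg_eq_zero_iff hx hy).1 h, mul_div_cancel₀ _ hs, Real.cos_pi]
  · have h1 := mul_norm_neg_kAdd_sq hx hy h
    have hb : 1 + form κ (lift κ x) (lift κ y) ≠ 0 := fun h0 =>
      h ((addDen_neg_eq_zero_iff hx hy).2 (by linarith))
    have e : √κ * kDist κ x y = 2 * Real.arctan (√κ * ‖kAdd κ (-x) y‖) := by
      rw [kDist, if_neg h, arctanK, if_pos hκ]
      field_simp
    rw [e, Real.cos_two_mul, Real.cos_sq_arctan, mul_pow, Real.sq_sqrt hκ.le, h1]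
    field_simp
    ring

theorem abs_sqrt_mul_norm_lt_one (hκ : κ < 0) {x : E d} (hx : x ∈ st κ d) :
    √(-κ) * ‖x‖ ∈ Set.Ioo (-1 : ℝ) 1 := by
  rw [Set.mem_Ioo, ← abs_lt, ← sq_lt_one_iff_abs_lt_one, mul_pow, Real.sq_sqrt (by linarith)]
  exact hx

theorem tanh_kDist_sq (hκ : κ < 0) {x y : E d} (hx : x ∈ st κ d) (hy : y ∈ st κ d) :
    Real.tanh (√(-κ) * kDist κ x y / 2) ^ 2 = 1 - 2 / (1 + form κ (lift κ x) (lift κ y)) := by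
  have hs : √(-κ) ≠ 0 := (Real.sqrt_pos.2 (by linarith)).ne'
  have h := (addDen_pos hκ.le (neg_mem_st hx) hy).ne'
  have h1 := mul_norm_neg_kAdd_sq hx hy h
  have e : √(-κ) * kDist κ x y / 2 = Real.artanh (√(-κ) * ‖kAdd κ (-x) y‖) := by
    rw [kDist, if_neg h, arctanK, if_neg hκ.not_gt, if_pos hκ]
    field_simp
  rw [e, Real.tanh_artanh (abs_sqrt_mul_norm_lt_one hκ (kAdd_mem_st (neg_mem_st hx) hy h)),
    mul_pow, Real.sq_sqrt (by linarith), ← h1]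
  ring

/-- Bridge from metric to linear algebra. It fails at `κ = 0`, where `form` is `1` on all pairs of
lifts. -/
theorem kDist_eq_iff (hκ : κ ≠ 0) {x y x' y' : E d} (hx : x ∈ st κ d) (hy : y ∈ st κ d)
    (hx' : x' ∈ st κ d) (hy' : y' ∈ st κ d) :
    kDist κ x y = kDist κ x' y' ↔
      form κ (lift κ x) (lift κ y) = form κ (lift κ x') (lift κ y') := by
  constructor
  · intro h
    rcases hκ.lt_or_gt with hκ | hκ
    · have h1 := tanh_kDist_sq hκ hx hy
      rw [h, tanh_kDist_sq hκ hx' hy'] at h1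
      have h2 := one_le_form_lift hκ.le hx hy
      have h3 := one_le_form_lift hκ.le hx' hy'
      have h4 : 1 + form κ (lift κ x) (lift κ y) ≠ 0 := by linarith
      have h5 : 1 + form κ (lift κ x') (lift κ y') ≠ 0 := by linarith
      field_simp at h1
      linarith
    · rw [← cos_kDist hκ hx hy, h, cos_kDist hκ hx' hy']
  · intro h
    by_cases h0 : addDen κ (-x) y = 0
    · have h0' : addDen κ (-x') y' = 0 := by
        rw [addDen_neg_eq_zero_iff hx' hy', ← h, ← addDen_neg_eq_zero_iff hx hy, h0]
      rw [kDist, kDist, if_pos h0, if_pos h0']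
    · have h0' : addDen κ (-x') y' ≠ 0 := by
        rwa [Ne, addDen_neg_eq_zero_iff hx' hy', ← h, ← addDen_neg_eq_zero_iff hx hy]
      have h1 := mul_norm_neg_kAdd_sq hx hy h0
      rw [h, ← mul_norm_neg_kAdd_sq hx' hy' h0'] at h1
      have h2 : ‖kAdd κ (-x) y‖ = ‖kAdd κ (-x') y'‖ := by
        rw [← sq_eq_sq₀ (norm_nonneg _) (norm_nonneg _)]
        exact mul_left_cancel₀ hκ (add_left_cancel h1)
      rw [kDist, kDist, if_neg h0, if_neg h0', h2]

/-! ### The scaling -/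

theorem tan_half_arctan (u : ℝ) : Real.tan (Real.arctan u / 2) = u / (1 + √(1 + u ^ 2)) := by
  have hpos := Real.cos_arctan_pos u
  have hc := Real.cos_two_mul (Real.arctan u / 2)
  have hs := Real.sin_two_mul (Real.arctan u / 2)
  rw [mul_div_cancel₀ _ (two_ne_zero' ℝ)] at hc hs
  have h0 : Real.cos (Real.arctan u / 2) ≠ 0 := by
    intro h
    rw [h] at hc
    linarith
  have e : Real.tan (Real.arctan u / 2) =
      Real.sin (Real.arctan u) / (1 + Real.cos (Real.arctan u)) := by
    rw [Real.tan_eq_sin_div_cos, hs, hc]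
    field_simp
    ring
  have hp : 0 < √(1 + u ^ 2) := by positivity
  rw [e, Real.sin_arctan, Real.cos_arctan]
  field_simp
  ring

theorem tanh_half_artanh {u : ℝ} (hu : u ∈ Set.Ioo (-1 : ℝ) 1) :
    Real.tanh (Real.artanh u / 2) = u / (1 + √(1 - u ^ 2)) := by
  have hc := Real.cosh_two_mul (Real.artanh u / 2)
  have hs := Real.sinh_two_mul (Real.artanh u / 2)
  have h1 := Real.cosh_sq (Real.artanh u / 2)
  rw [mul_div_cancel₀ _ (two_ne_zero' ℝ)] at hc hs
  have h0 := (Real.cosh_pos (Real.artanh u / 2)).ne'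
  have e : Real.tanh (Real.artanh u / 2) =
      Real.sinh (Real.artanh u) / (1 + Real.cosh (Real.artanh u)) := by
    have h2 : 1 + Real.cosh (Real.artanh u) = 2 * Real.cosh (Real.artanh u / 2) ^ 2 := by
      linarith
    rw [Real.tanh_eq_sinh_div_cosh, hs, h2]
    field_simp
  have hp : 0 < √(1 - u ^ 2) := by
    rw [Real.sqrt_pos, sub_pos, sq_lt_one_iff_abs_lt_one, abs_lt]
    exact hu
  rw [e, Real.sinh_artanh hu, Real.cosh_artanh hu]
  field_simp
  ring

theorem kSmul_one {x : E d} (hx : x ∈ st κ d) : kSmul κ 1 x = x := by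
  have e : tanK κ (1 * arctanK κ ‖x‖) = ‖x‖ := by
    rw [one_mul, tanK, arctanK]
    split_ifs with h1 h2
    · have hs : √κ ≠ 0 := (Real.sqrt_pos.2 h1).ne'
      rw [mul_div_cancel₀ _ hs, Real.tan_arctan, mul_div_cancel_left₀ _ hs]
    · have hs : √(-κ) ≠ 0 := (Real.sqrt_pos.2 (by linarith)).ne'
      rw [mul_div_cancel₀ _ hs, Real.tanh_artanh (abs_sqrt_mul_norm_lt_one h2 hx),
        mul_div_cancel_left₀ _ hs]
    · rfl
  rcases eq_or_ne x 0 with rfl | h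
  · simp [kSmul]
  · rw [kSmul, e, div_self (norm_ne_zero_iff.2 h), one_smul]

/-- The half-angle formulas give one algebraic expression for all signs of `κ`. -/
theorem kSmul_half {x : E d} (hx : x ∈ st κ d) :
    kSmul κ (1 / 2) x = (1 + √(1 + κ * ‖x‖ ^ 2))⁻¹ • x := by
  have e : tanK κ (1 / 2 * arctanK κ ‖x‖) = ‖x‖ / (1 + √(1 + κ * ‖x‖ ^ 2)) := by
    rw [tanK, arctanK]
    split_ifs with h1 h2
    · have hs : √κ ≠ 0 := (Real.sqrt_pos.2 h1).ne'
      rw [show √κ * (1 / 2 * (Real.arctan (√κ * ‖x‖) / √κ)) = Real.arctan (√κ * ‖x‖) / 2 by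
        field_simp, tan_half_arctan, mul_pow, Real.sq_sqrt h1.le]
      field_simp
    · have hs : √(-κ) ≠ 0 := (Real.sqrt_pos.2 (by linarith)).ne'
      rw [show √(-κ) * (1 / 2 * (Real.artanh (√(-κ) * ‖x‖) / √(-κ))) =
        Real.artanh (√(-κ) * ‖x‖) / 2 by field_simp,
        tanh_half_artanh (abs_sqrt_mul_norm_lt_one h2 hx), mul_pow, Real.sq_sqrt (by linarith),
        neg_mul, sub_neg_eq_add]
      field_simp
    · have h0 : κ = 0 := le_antisymm (not_lt.1 h1) (not_lt.1 h2)
      simp [h0]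
      ring
  rcases eq_or_ne x 0 with rfl | h
  · simp [kSmul]
  · have hn := norm_ne_zero_iff.2 h
    rw [kSmul, e]
    congr 1
    field_simp

/-! ### The gyromidpoint -/

/-- The weighted sum of the lifted points. -/
def liftSum (κ : ℝ) (α : Fin n → ℝ) (x : Fin n → E d) : ℝ × E d := ∑ j, α j • lift κ (x j)

theorem liftSum_fst (α : Fin n → ℝ) (x : Fin n → E d) : (liftSum κ α x).1 = midDen κ α x := by
  simp [liftSum, midDen, lift, Prod.fst_sum]

theorem midDouble_eq (α : Fin n → ℝ) (x : Fin n → E d) :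
    midDouble κ α x = (midDen κ α x)⁻¹ • (liftSum κ α x).2 := by
  simp only [liftSum, midDouble, lift, Prod.snd_sum, Prod.smul_snd, Finset.smul_sum, smul_smul]
  refine Finset.sum_congr rfl fun i _ => ?_
  congr 1
  ring

theorem midDen_sq_mul {α : Fin n → ℝ} {x : Fin n → E d} (h : midDen κ α x ≠ 0) :
    midDen κ α x ^ 2 * (1 + κ * ‖midDouble κ α x‖ ^ 2) =
      form κ (liftSum κ α x) (liftSum κ α x) := by
  rw [form_self, liftSum_fst, midDouble_eq, norm_smul, mul_pow, Real.norm_eq_abs, sq_abs]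
  field_simp

theorem midDefined_iff {α : Fin n → ℝ} {x : Fin n → E d} : MidDefined κ α x ↔
    midDen κ α x ≠ 0 ∧ 0 < form κ (liftSum κ α x) (liftSum κ α x) := by
  refine and_congr_right fun h => ?_
  rw [← midDen_sq_mul h, mem_st, mul_pos_iff_of_pos_left (by positivity)]

theorem form_sum_sum (α : Fin n → ℝ) (x : Fin n → E d) (β : Fin m → ℝ) (y : Fin m → E d) :
    form κ (liftSum κ α x) (liftSum κ β y) =
      ∑ i, ∑ j, α i * (β j * form κ (lift κ (x i)) (lift κ (y j))) := by
  simp only [liftSum, map_sum, LinearMap.sum_apply, map_smul, LinearMap.smul_apply, smul_eq_mul,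
    Finset.mul_sum]
  rw [Finset.sum_comm]
  refine Finset.sum_congr rfl fun i _ => Finset.sum_congr rfl fun j _ => by ring

theorem form_sum_left (α : Fin n → ℝ) (x : Fin n → E d) (p : ℝ × E d) :
    form κ (liftSum κ α x) p = ∑ i, α i * form κ (lift κ (x i)) p := by
  simp [liftSum, map_sum, LinearMap.sum_apply]

/-- `midDouble` is a ratio, so `c` cancels, whatever its sign. Positivity of `conf κ p - 1` selects
the right square root in `kSmul_half`. -/
theorem midDefined_of_liftSum_eq {α : Fin n → ℝ} {x : Fin n → E d} {c : ℝ} {p : E d}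
    (hc : c ≠ 0) (hp : p ∈ st κ d) (hp1 : 0 < conf κ p - 1)
    (h : liftSum κ α x = c • lift κ p) :
    MidDefined κ α x ∧ gyromidpoint κ α x = p := by
  have hT : midDen κ α x = c * (conf κ p - 1) := by
    rw [← liftSum_fst, h]; simp [lift]
  have hT0 : midDen κ α x ≠ 0 := by
    rw [hT]; exact mul_ne_zero hc hp1.ne'
  have hq : form κ (liftSum κ α x) (liftSum κ α x) = c ^ 2 := by
    rw [h]
    simp only [map_smul, LinearMap.smul_apply, form_lift_self hp, smul_eq_mul]
    ring
  have hdef : MidDefined κ α x := midDefined_iff.2 ⟨hT0, by rw [hq]; positivity⟩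
  refine ⟨hdef, ?_⟩
  have hs : 1 + κ * ‖midDouble κ α x‖ ^ 2 = ((conf κ p - 1)⁻¹) ^ 2 := by
    have h1 := midDen_sq_mul hT0
    rw [hq, hT] at h1
    have h2 := hp1.ne'
    field_simp
    have h3 : c ^ 2 ≠ 0 := pow_ne_zero _ hc
    apply mul_left_cancel₀ h3
    linear_combination h1
  rw [gyromidpoint, kSmul_half hdef.2, hs, Real.sqrt_sq (inv_pos.2 hp1).le, midDouble_eq, h, hT]
  simp only [lift, Prod.smul_mk, smul_smul]
  have h2 := hp1.ne'
  have h3 := (conf_pos hp).ne'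
  rw [show (1 + (conf κ p - 1)⁻¹)⁻¹ * ((c * (conf κ p - 1))⁻¹ * (c * conf κ p)) = 1 by
    have : 1 + (conf κ p - 1)⁻¹ ≠ 0 := by positivity
    field_simp
    ring, one_smul]

theorem gyromidpoint_spec {α : Fin n → ℝ} {x : Fin n → E d} (h : MidDefined κ α x) :
    gyromidpoint κ α x ∈ st κ d ∧ 0 < conf κ (gyromidpoint κ α x) - 1 ∧
      ∃ c : ℝ, c ≠ 0 ∧ liftSum κ α x = c • lift κ (gyromidpoint κ α x) := by
  obtain ⟨hT, hq⟩ := midDefined_iff.1 h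
  have hT2 : 0 < |midDen κ α x| := abs_pos.2 hT
  set q := form κ (liftSum κ α x) (liftSum κ α x) with hq_def
  -- The root of `q` gets the sign of `midDen`, so that the normalised sum has positive first
  -- coordinate and is a lift.
  obtain ⟨c, hc2, hcT⟩ : ∃ c : ℝ, c ^ 2 = q ∧ 0 < c⁻¹ * midDen κ α x := by
    rcases hT.lt_or_gt with hT | hT
    · refine ⟨-√q, by rw [neg_sq, Real.sq_sqrt hq.le], ?_⟩
      exact mul_pos_of_neg_of_neg (inv_neg''.2 (neg_neg_of_pos (Real.sqrt_pos.2 hq))) hT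
    · exact ⟨√q, Real.sq_sqrt hq.le, mul_pos (inv_pos.2 (Real.sqrt_pos.2 hq)) hT⟩
  have hc : c ≠ 0 := by
    rintro rfl
    simp at hcT
  have hp : form κ (c⁻¹ • liftSum κ α x) (c⁻¹ • liftSum κ α x) = 1 := by
    simp only [map_smul, LinearMap.smul_apply, smul_eq_mul, ← hq_def, ← hc2]
    field_simp
  have hp1 : (c⁻¹ • liftSum κ α x).1 = c⁻¹ * midDen κ α x := by
    rw [Prod.smul_fst, liftSum_fst, smul_eq_mul]
  obtain ⟨p, hpst, hpl⟩ := exists_lift_eq hp (by rw [hp1]; linarith)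
  have hconf : 0 < conf κ p - 1 := by
    have : (lift κ p).1 = c⁻¹ * midDen κ α x := by rw [hpl, hp1]
    rw [← this] at hcT
    exact hcT
  have hsum : liftSum κ α x = c • lift κ p := by rw [hpl, smul_inv_smul₀ hc]
  rw [(midDefined_of_liftSum_eq hc hpst hconf hsum).2]
  exact ⟨hpst, hconf, c, hc, hsum⟩

theorem midDefined_of_nonpos (hκ : κ ≤ 0) {α : Fin n → ℝ} (hα : ∀ j, 0 ≤ α j)
    (hα1 : ∑ j, α j = 1) {x : Fin n → E d} (hx : ∀ j, x j ∈ st κ d) : MidDefined κ α x := by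
  have hq : 1 ≤ form κ (liftSum κ α x) (liftSum κ α x) := by
    rw [form_sum_sum]
    calc (1 : ℝ) = ∑ i, ∑ j, α i * α j := by
          rw [← Finset.sum_mul_sum, hα1, one_mul]
      _ ≤ _ := Finset.sum_le_sum fun i _ => Finset.sum_le_sum fun j _ =>
          mul_le_mul_of_nonneg_left
            (le_mul_of_one_le_right (hα j) (one_le_form_lift hκ (hx i) (hx j))) (hα i)
  refine midDefined_iff.2 ⟨fun h0 => ?_, by linarith⟩
  rw [form_self, liftSum_fst, h0] at hq
  nlinarith [mul_nonpos_of_nonpos_of_nonneg hκ (sq_nonneg ‖(liftSum κ α x).2‖)]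

/-- A point of the model with `t > 0` is its own gyromidpoint. -/
theorem midDefined_single {p : E d} (hp : p ∈ st κ d) (hp1 : 0 < conf κ p - 1) :
    MidDefined κ (fun _ : Fin 1 => 1) (fun _ => p) ∧
      gyromidpoint κ (fun _ : Fin 1 => 1) (fun _ => p) = p :=
  midDefined_of_liftSum_eq one_ne_zero hp hp1 (by simp [liftSum])

/-! ### Congruent point systems -/

theorem midDen_zero_curvature (α : Fin n → ℝ) (x : Fin n → E d) :
    midDen 0 α x = ∑ j, α j := by
  simp [midDen, conf, show (2 : ℝ) - 1 = 1 by norm_num]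

theorem midDefined_zero_curvature {α : Fin n → ℝ} (hα : ∑ j, α j = 1) (x : Fin n → E d) :
    MidDefined 0 α x :=
  ⟨by rw [midDen_zero_curvature, hα]; exact one_ne_zero, by simp [st]⟩

theorem gyromidpoint_zero_curvature {α : Fin n → ℝ} (hα : ∑ j, α j = 1) (x : Fin n → E d) :
    gyromidpoint 0 α x = ∑ j, α j • x j := by
  rw [gyromidpoint, kSmul_half (midDefined_zero_curvature hα x).2, midDouble,
    midDen_zero_curvature, hα, Finset.smul_sum]
  refine Finset.sum_congr rfl fun j _ => ?_
  rw [smul_smul]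
  congr 1
  simp [conf]
  ring

theorem norm_sum_smul_sub_sum_smul_sq {F : Type*} [NormedAddCommGroup F] [InnerProductSpace ℝ F]
    {ι ι' : Type*} [Fintype ι] [Fintype ι'] {α : ι → ℝ} {β : ι' → ℝ} (hα : ∑ j, α j = 1)
    (hβ : ∑ j, β j = 1) (x : ι → F) (y : ι' → F) :
    ‖∑ j, α j • x j - ∑ j, β j • y j‖ ^ 2 =
      ∑ i, ∑ j, α i * β j * ‖x i - y j‖ ^ 2 - (∑ i, ∑ j, α i * α j * ‖x i - x j‖ ^ 2) / 2 -
        (∑ i, ∑ j, β i * β j * ‖y i - y j‖ ^ 2) / 2 := by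
  -- The difference is a combination of the joint family with weights `α` and `-β` of total zero, so
  -- its norm depends only on mutual distances.
  have h0 : ∑ j, Sum.elim α (fun j => -β j) j = 0 := by
    simp [Fintype.sum_sum_type, hα, hβ]
  have h := inner_sum_smul_sum_smul_of_sum_eq_zero (Sum.elim x y) h0 (Sum.elim x y) h0
  simp only [Fintype.sum_sum_type, Sum.elim_inl, Sum.elim_inr, neg_smul, Finset.sum_neg_distrib,
    ← sub_eq_add_neg, real_inner_self_eq_norm_sq, ← pow_two] at h
  rw [h]
  have h1 : ∑ i, ∑ j, -β i * α j * ‖y i - x j‖ ^ 2 = -∑ i, ∑ j, α i * β j * ‖x i - y j‖ ^ 2 := by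
    rw [Finset.sum_comm, ← Finset.sum_neg_distrib]
    refine Finset.sum_congr rfl fun i _ => ?_
    rw [← Finset.sum_neg_distrib]
    refine Finset.sum_congr rfl fun j _ => ?_
    rw [norm_sub_rev]; ring
  simp only [Finset.sum_add_distrib, h1]
  simp only [mul_neg, neg_mul, neg_neg, Finset.sum_neg_distrib]
  ring

/-- In a congruent system of points the lifted sum has the same multiple of a point of the model. -/
theorem exists_liftSum_eq (hκ : κ ≠ 0) {α : Fin n → ℝ} {x x' : Fin n → E d}
    (hx : ∀ j, x j ∈ st κ d) (hx' : ∀ j, x' j ∈ st κ d)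
    (hd : ∀ i j, kDist κ (x' i) (x' j) = kDist κ (x i) (x j)) (h : MidDefined κ α x)
    (hs : 0 < κ → 0 < midDen κ α x * midDen κ α x') :
    MidDefined κ α x' ∧ ∃ c : ℝ, c ≠ 0 ∧ liftSum κ α x = c • lift κ (gyromidpoint κ α x) ∧
      liftSum κ α x' = c • lift κ (gyromidpoint κ α x') := by
  have hf : ∀ i j, form κ (lift κ (x' i)) (lift κ (x' j)) =
      form κ (lift κ (x i)) (lift κ (x j)) := fun i j =>
    (kDist_eq_iff hκ (hx' i) (hx' j) (hx i) (hx j)).1 (hd i j)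
  have hq : form κ (liftSum κ α x') (liftSum κ α x') =
      form κ (liftSum κ α x) (liftSum κ α x) := by
    simp only [form_sum_sum, hf]
  obtain ⟨hT, hq0⟩ := midDefined_iff.1 h
  have hT' : midDen κ α x' ≠ 0 := by
    rcases hκ.lt_or_gt with hκ | hκ
    · intro h0
      rw [← hq, form_self, liftSum_fst, h0] at hq0
      nlinarith [mul_nonpos_of_nonpos_of_nonneg hκ.le (sq_nonneg ‖(liftSum κ α x').2‖)]
    · exact right_ne_zero_of_mul (hs hκ).ne'
  have h' : MidDefined κ α x' := midDefined_iff.2 ⟨hT', by rwa [hq]⟩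
  obtain ⟨hm, hm1, c, hc, hsum⟩ := gyromidpoint_spec h
  obtain ⟨hm', hm1', c', hc', hsum'⟩ := gyromidpoint_spec h'
  have hcc : c' ^ 2 = c ^ 2 := by
    rw [hsum, hsum'] at hq
    simp only [map_smul, LinearMap.smul_apply, form_lift_self hm, form_lift_self hm',
      smul_eq_mul] at hq
    linarith
  have hpos : 0 < c * c' := by
    rcases hκ.lt_or_gt with hκ | hκ
    · obtain ⟨j, -, -⟩ := Finset.exists_ne_zero_of_sum_ne_zero hT
      have e : form κ (liftSum κ α x') (lift κ (x' j)) =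
          form κ (liftSum κ α x) (lift κ (x j)) := by
        simp only [form_sum_left, hf]
      rw [hsum, hsum'] at e
      simp only [map_smul, LinearMap.smul_apply, smul_eq_mul] at e
      have h1 := one_le_form_lift hκ.le hm (hx j)
      have h2 := one_le_form_lift hκ.le hm' (hx' j)
      have h3 : c * c' * form κ (lift κ (gyromidpoint κ α x')) (lift κ (x' j)) =
          c ^ 2 * form κ (lift κ (gyromidpoint κ α x)) (lift κ (x j)) := by
        linear_combination c * e
      have h4 : 0 < c ^ 2 * form κ (lift κ (gyromidpoint κ α x)) (lift κ (x j)) := by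
        positivity
      rw [← h3] at h4
      exact (pos_iff_pos_of_mul_pos h4).2 (by linarith)
    · have h1 := hs hκ
      rw [← liftSum_fst, ← liftSum_fst, hsum, hsum'] at h1
      simp only [lift, Prod.smul_mk, smul_eq_mul] at h1
      have h2 : 0 < (c * c') *
          ((conf κ (gyromidpoint κ α x) - 1) * (conf κ (gyromidpoint κ α x') - 1)) := by
        linarith
      exact (pos_iff_pos_of_mul_pos h2).2 (mul_pos hm1 hm1')
  have hc_eq : c' = c := by
    rcases sq_eq_sq_iff_eq_or_eq_neg.1 hcc with h | h
    · exact h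
    · rw [h] at hpos
      nlinarith [sq_nonneg c]
  exact ⟨h', c, hc, hsum, by rw [hsum', hc_eq]⟩

theorem kDist_gyromidpoint_eq {α : Fin n → ℝ} {β : Fin m → ℝ} (hα : ∑ j, α j = 1)
    (hβ : ∑ j, β j = 1) {x x' : Fin n → E d} {y y' : Fin m → E d}
    (hx : ∀ j, x j ∈ st κ d) (hx' : ∀ j, x' j ∈ st κ d)
    (hy : ∀ j, y j ∈ st κ d) (hy' : ∀ j, y' j ∈ st κ d)
    (hdx : ∀ i j, kDist κ (x' i) (x' j) = kDist κ (x i) (x j))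
    (hdy : ∀ i j, kDist κ (y' i) (y' j) = kDist κ (y i) (y j))
    (hdxy : ∀ i j, kDist κ (x' i) (y' j) = kDist κ (x i) (y j))
    (h : MidDefined κ α x) (k : MidDefined κ β y)
    (hs : 0 < κ → 0 < midDen κ α x * midDen κ α x')
    (ks : 0 < κ → 0 < midDen κ β y * midDen κ β y') :
    MidDefined κ α x' ∧ MidDefined κ β y' ∧
      kDist κ (gyromidpoint κ α x') (gyromidpoint κ β y') =
        kDist κ (gyromidpoint κ α x) (gyromidpoint κ β y) := by
  rcases eq_or_ne κ 0 with rfl | hκ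
  · refine ⟨midDefined_zero_curvature hα x', midDefined_zero_curvature hβ y', ?_⟩
    simp only [kDist_zero_curvature, mul_right_inj' (two_ne_zero' ℝ)] at *
    rw [gyromidpoint_zero_curvature hα, gyromidpoint_zero_curvature hα,
      gyromidpoint_zero_curvature hβ, gyromidpoint_zero_curvature hβ,
      ← sq_eq_sq₀ (norm_nonneg _) (norm_nonneg _), norm_sum_smul_sub_sum_smul_sq hα hβ,
      norm_sum_smul_sub_sum_smul_sq hα hβ]
    simp only [hdx, hdy, hdxy]
  · obtain ⟨h', c, hc, hX, hX'⟩ := exists_liftSum_eq hκ hx hx' hdx h hs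
    obtain ⟨k', e, he, hY, hY'⟩ := exists_liftSum_eq hκ hy hy' hdy k ks
    refine ⟨h', k', ?_⟩
    rw [kDist_eq_iff hκ (gyromidpoint_spec h').1 (gyromidpoint_spec k').1
      (gyromidpoint_spec h).1 (gyromidpoint_spec k).1]
    have hf : form κ (liftSum κ α x') (liftSum κ β y') =
        form κ (liftSum κ α x) (liftSum κ β y) := by
      simp only [form_sum_sum]
      refine Finset.sum_congr rfl fun i _ => Finset.sum_congr rfl fun j _ => ?_
      rw [(kDist_eq_iff hκ (hx' i) (hy' j) (hx i) (hy j)).1 (hdxy i j)]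
    rw [hX, hY, hX', hY'] at hf
    simp only [map_smul, LinearMap.smul_apply, smul_eq_mul] at hf
    exact mul_left_cancel₀ hc (mul_left_cancel₀ he hf)

theorem eq_of_kDist_eq_kDist_self {x y z : E d} (hx : x ∈ st κ d) (hy : y ∈ st κ d)
    (hz : z ∈ st κ d) (h : kDist κ x y = kDist κ z z) : x = y := by
  rcases eq_or_ne κ 0 with rfl | hκ
  · rw [kDist_zero_curvature, kDist_zero_curvature, sub_self, norm_zero, mul_zero] at h
    simpa [sub_eq_zero] using h
  · rw [kDist_eq_iff hκ hx hy hz hz, form_lift_self hz] at h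
    exact eq_of_form_lift_eq_one hκ hx hy h

/-! ### Isometries -/

theorem lift_zero : lift κ (0 : E d) = (1, 0) := by
  simp [lift, conf, show (2 : ℝ) - 1 = 1 by norm_num]

/-- The linear map of the ambient space which is determined by the values of an isometry at the
origin and at the points of the coordinate axes on the equator. -/
def ambientMap (κ : ℝ) (φ : E d → E d) : (ℝ × E d) →ₗ[ℝ] (ℝ × E d) :=
  (LinearMap.fst ℝ ℝ (E d)).smulRight (lift κ (φ 0)) +
    ∑ i, ((EuclideanSpace.proj i : E d →L[ℝ] ℝ).toLinearMap ∘ₗ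
      LinearMap.snd ℝ ℝ (E d)).smulRight
        (√κ • lift κ (φ ((√κ)⁻¹ • EuclideanSpace.single i 1)))

theorem ambientMap_apply (φ : E d → E d) (p : ℝ × E d) : ambientMap κ φ p =
    p.1 • lift κ (φ 0) +
      ∑ i, p.2 i • √κ • lift κ (φ ((√κ)⁻¹ • EuclideanSpace.single i 1)) := by
  simp [ambientMap, LinearMap.sum_apply]

/-- The lifts of `0` and of `(√κ)⁻¹ eᵢ` are `(1, 0)` and `(0, (√κ)⁻¹ eᵢ)`, a basis of the ambient
space, so the pairing need only be checked there. -/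
theorem form_ambientMap_left (hκ : 0 < κ) {φ : E d → E d} {u : ℝ × E d}
    {g : ℝ × E d}
    (h0 : form κ (lift κ (φ 0)) u = form κ (lift κ 0) g)
    (h1 : ∀ i, form κ (lift κ (φ ((√κ)⁻¹ • EuclideanSpace.single i 1))) u =
      form κ (lift κ ((√κ)⁻¹ • EuclideanSpace.single i 1)) g) (p : ℝ × E d) :
    form κ (ambientMap κ φ p) u = form κ p g := by
  have hs : √κ ≠ 0 := (Real.sqrt_pos.2 hκ).ne'
  have hss : √κ ^ 2 = κ := Real.sq_sqrt hκ.le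
  have hc : ∀ i : Fin d, conf κ ((√κ)⁻¹ • EuclideanSpace.single i (1 : ℝ)) = 1 := fun i => by
    rw [conf, norm_smul, mul_pow, norm_inv, inv_pow, Real.norm_eq_abs, sq_abs, hss]
    simp [hκ.ne']
    norm_num
  rw [ambientMap_apply]
  simp only [map_add, map_sum, map_smul, LinearMap.add_apply, LinearMap.sum_apply,
    LinearMap.smul_apply, h0, h1, smul_eq_mul]
  simp only [lift_zero]
  simp only [form_apply, lift, hc, real_inner_smul_left]
  simp [EuclideanSpace.inner_single_left]
  have e : inner ℝ p.2 g.2 = ∑ i, p.2 i * g.2 i := by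
    rw [PiLp.inner_apply]
    exact Finset.sum_congr rfl fun i _ => by simp [mul_comm]
  rw [e, Finset.mul_sum]
  refine Finset.sum_congr rfl fun i _ => ?_
  field_simp

theorem form_isom (hκ : κ ≠ 0) {φ : E d → E d} (hφ : IsIsom κ φ) {x y : E d} (hx : x ∈ st κ d)
    (hy : y ∈ st κ d) :
    form κ (lift κ (φ x)) (lift κ (φ y)) = form κ (lift κ x) (lift κ y) :=
  (kDist_eq_iff hκ (hφ.1 hx) (hφ.1 hy) hx hy).1 (hφ.2 x hx y hy)

theorem mem_st_of_pos (hκ : 0 < κ) (x : E d) : x ∈ st κ d := by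
  rw [mem_st]; positivity

theorem eq_zero_of_form_self (hκ : 0 < κ) {p : ℝ × E d} (h : form κ p p = 0) : p = 0 := by
  rw [form_self] at h
  have h1 : 0 ≤ κ * ‖p.2‖ ^ 2 := by positivity
  have h2 : p.1 ^ 2 = 0 := by nlinarith [sq_nonneg p.1]
  have h3 : κ * ‖p.2‖ ^ 2 = 0 := by nlinarith [sq_nonneg p.1]
  refine Prod.ext (by simpa using h2) (by simpa [hκ.ne'] using h3)

/-- The ambient map preserves `form`, hence is bijective. The preimage `u` of `-lift κ 0` cannot be
a lift, since its image would then be antipodal to the lift of `0`, which no lift is. The only other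
point of the sphere is `-lift κ 0` itself. -/
theorem isom_zero (hκ : 0 < κ) {φ : E d → E d} (hφ : IsIsom κ φ) : φ 0 = 0 := by
  have hm := mem_st_of_pos (d := d) hκ
  have hLφ : ∀ (p : ℝ × E d) (x : E d),
      form κ (ambientMap κ φ p) (lift κ (φ x)) = form κ p (lift κ x) := fun p x =>
    form_ambientMap_left hκ (form_isom hκ.ne' hφ (hm _) (hm _))
      (fun i => form_isom hκ.ne' hφ (hm _) (hm _)) p
  have hLL : ∀ p q : ℝ × E d, form κ (ambientMap κ φ p) (ambientMap κ φ q) = form κ p q :=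
    fun p q => form_ambientMap_left hκ
      (by rw [form_comm, hLφ, form_comm]) (fun i => by rw [form_comm, hLφ, form_comm]) p
  have hinj : Function.Injective (ambientMap κ φ) := by
    rw [injective_iff_map_eq_zero]
    intro p hp
    refine eq_zero_of_form_self hκ ?_
    rw [← hLL, hp, map_zero]
  obtain ⟨u, hu⟩ := (LinearMap.injective_iff_surjective.1 hinj) (-lift κ 0)
  have hu1 : form κ u u = 1 := by
    rw [← hLL, hu]
    simp [form_lift_self (hm 0)]
  by_cases h : -1 < u.1
  · obtain ⟨x, -, rfl⟩ := exists_lift_eq hu1 h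
    have h1 : form κ (lift κ (0 : E d)) (lift κ (φ x)) = -1 := by
      have := hLφ (lift κ x) x
      rw [hu, form_lift_self (hm x)] at this
      simp only [map_neg, LinearMap.neg_apply] at this
      linarith
    rw [lift_zero, form_apply, inner_zero_left] at h1
    simp only [lift] at h1
    linarith [conf_pos (hm (φ x))]
  · have hu2 : u = -lift κ 0 := by
      rw [form_self] at hu1
      have h3 : 0 ≤ κ * ‖u.2‖ ^ 2 := by positivity
      have h4 : u.1 = -1 := by nlinarith
      rw [h4] at hu1
      have h5 : κ * ‖u.2‖ ^ 2 = 0 := by linarith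
      rw [lift_zero]
      exact Prod.ext (by simpa using h4) (by simpa [hκ.ne'] using h5)
    have h6 : lift κ (φ 0) = lift κ 0 := by
      rw [hu2, map_neg, neg_inj, lift_zero, ambientMap_apply] at hu
      simpa [lift_zero] using hu
    exact lift_injOn (hm _) (hm _) h6

theorem conf_isom (hκ : 0 < κ) {φ : E d → E d} (hφ : IsIsom κ φ) (x : E d) :
    conf κ (φ x) = conf κ x := by
  have h := form_isom hκ.ne' hφ (mem_st_of_pos hκ x) (mem_st_of_pos hκ 0)
  rw [isom_zero hκ hφ, lift_zero] at h
  simpa [form_apply, lift] using h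

theorem midDen_isom (hκ : 0 < κ) {φ : E d → E d} (hφ : IsIsom κ φ) (α : Fin n → ℝ)
    (x : Fin n → E d) : midDen κ α (fun j => φ (x j)) = midDen κ α x := by
  simp only [midDen, conf_isom hκ hφ]

/-- Both `p` and `φ p` are their own one-point midpoints, so comparing the systems `(x, p)` and `(φ
x, φ p)` gives the new midpoint the same distance to `φ p` as `p` has to itself. -/
theorem gyromidpoint_isom {α : Fin n → ℝ} (hα : ∑ j, α j = 1) {x : Fin n → E d}
    (hx : ∀ j, x j ∈ st κ d) {φ : E d → E d} (hφ : IsIsom κ φ) (h : MidDefined κ α x) :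
    MidDefined κ α (fun j => φ (x j)) ∧
      gyromidpoint κ α (fun j => φ (x j)) = φ (gyromidpoint κ α x) := by
  obtain ⟨hm, hm1, c, hc, hsum⟩ := gyromidpoint_spec h
  set p := gyromidpoint κ α x with hp
  have hpm : midDen κ α x * midDen κ α x > 0 := mul_self_pos.2 h.1
  have hp1 : 0 < conf κ (φ p) - 1 := by
    rcases lt_trichotomy κ 0 with hκ | rfl | hκ
    · linarith [one_le_conf_sub_one hκ (hφ.1 hm)]
    · simp [conf]
    · rwa [conf_isom hκ hφ]
  obtain ⟨hs, hs'⟩ := midDefined_single hm hm1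
  obtain ⟨ks, ks'⟩ := midDefined_single (hφ.1 hm) hp1
  obtain ⟨h', -, hd⟩ := kDist_gyromidpoint_eq hα (by simp) hx (fun j => hφ.1 (hx j))
    (fun _ => hm) (fun _ => hφ.1 hm) (fun i j => hφ.2 _ (hx i) _ (hx j))
    (fun _ _ => hφ.2 _ hm _ hm) (fun i _ => hφ.2 _ (hx i) _ hm) h hs
    (fun hκ => by rwa [midDen_isom hκ hφ])
    (fun hκ => by rw [midDen_isom hκ hφ (fun _ : Fin 1 => 1) fun _ => p]; exact mul_self_pos.2 hs.1)
  rw [hs', ks', ← hp] at hd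
  exact ⟨h', eq_of_kDist_eq_kDist_self (gyromidpoint_spec h').1 (hφ.1 hm) hm hd⟩

/-! ### Motions -/

theorem map_linearIsometryEquiv_mem_st (R : E d ≃ₗᵢ[ℝ] E d) {x : E d} (hx : x ∈ st κ d) :
    R x ∈ st κ d := by
  rw [mem_st] at *
  rwa [R.norm_map]

theorem lift_linearIsometryEquiv (R : E d ≃ₗᵢ[ℝ] E d) (x : E d) :
    lift κ (R x) = LinearMap.prodMap LinearMap.id R.toLinearEquiv.toLinearMap (lift κ x) := by
  simp [lift, conf]

theorem gyromidpoint_motion {α : Fin n → ℝ} {x : Fin n → E d} (hx : ∀ j, x j ∈ st κ d)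
    {z : E d} (hz : z ∈ st κ d) (R : E d ≃ₗᵢ[ℝ] E d) (h : MidDefined κ α x)
    (hs : 0 < κ → (∀ j, addDen κ z (R (x j)) ≠ 0) ∧
      0 < midDen κ α x * midDen κ α (fun j => kAdd κ z (R (x j)))) :
    MidDefined κ α (fun j => kAdd κ z (R (x j))) ∧
      addDen κ z (R (gyromidpoint κ α x)) ≠ 0 ∧
      gyromidpoint κ α (fun j => kAdd κ z (R (x j))) = kAdd κ z (R (gyromidpoint κ α x)) := by
  obtain ⟨hm, hm1, c, hc, hsum⟩ := gyromidpoint_spec h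
  set p := gyromidpoint κ α x
  have hRx : ∀ j, R (x j) ∈ st κ d := fun j => map_linearIsometryEquiv_mem_st R (hx j)
  have hRp : R p ∈ st κ d := map_linearIsometryEquiv_mem_st R hm
  set M : (ℝ × E d) →ₗ[ℝ] (ℝ × E d) :=
    leftTrans κ z ∘ₗ LinearMap.prodMap LinearMap.id R.toLinearEquiv.toLinearMap with hM
  have hden : ∀ j, addDen κ z (R (x j)) ≠ 0 := fun j => by
    rcases le_or_gt κ 0 with hκ | hκ
    · exact (addDen_pos hκ hz (hRx j)).ne'
    · exact (hs hκ).1 j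
  have hsum' : liftSum κ α (fun j => kAdd κ z (R (x j))) = c • M (lift κ p) := by
    rw [← map_smul, ← hsum, liftSum, liftSum, map_sum]
    refine Finset.sum_congr rfl fun j _ => ?_
    rw [map_smul, lift_kAdd hz (hRx j) (hden j), lift_linearIsometryEquiv, hM,
      LinearMap.comp_apply]
  have hMp : (M (lift κ p)).1 = form κ (lift κ (-z)) (lift κ (R p)) := by
    rw [hM, LinearMap.comp_apply, ← lift_linearIsometryEquiv]
    rfl
  -- For `κ > 0` the product of the two `midDen` is `c²` times both first coordinates, so equal
  -- signs make the image's coordinate positive. This also excludes the value `-1` at which `z ⊕ R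
  -- p` would be undefined.
  have hpos : 0 < (M (lift κ p)).1 := by
    rcases le_or_gt κ 0 with hκ | hκ
    · rw [hMp]
      linarith [one_le_form_lift hκ (neg_mem_st hz) hRp]
    · have h1 := (hs hκ).2
      rw [← liftSum_fst, ← liftSum_fst, hsum, hsum', Prod.smul_fst, Prod.smul_fst, smul_eq_mul,
        smul_eq_mul] at h1
      have h2 : 0 < (c ^ 2 * (lift κ p).1) * (M (lift κ p)).1 := by linarith
      exact (pos_iff_pos_of_mul_pos h2).1 (mul_pos (by positivity) hm1)
  have hD : addDen κ z (R p) ≠ 0 := by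
    intro h0
    have h1 := addDen_eq hz hRp
    rw [h0, ← hMp] at h1
    linarith
  have hl : lift κ (kAdd κ z (R p)) = M (lift κ p) := by
    rw [lift_kAdd hz hRp hD, lift_linearIsometryEquiv, hM, LinearMap.comp_apply]
  rw [← hl] at hsum' hpos
  obtain ⟨h1, h2⟩ := midDefined_of_liftSum_eq hc (kAdd_mem_st hz hRp hD) hpos hsum'
  exact ⟨h1, hD, h2⟩

theorem leftMul_eq {A : Matrix (Fin n) (Fin n) ℝ} (hA : RowSumsOne A) {x : Fin n → E d}
    {i : Fin n} (h : MidDefined κ (A i) x) : leftMul κ A x i = gyromidpoint κ (A i) x := by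
  rw [leftMul, hA i, kSmul_one (gyromidpoint_spec h).1]

end KappaStereo

end

open KappaStereo

theorem theorem5 (κ : ℝ) (d n : ℕ) (A : Matrix (Fin n) (Fin n) ℝ)
    (hA : RowSumsOne A) (X : Fin n → E d)
    (hX : ∀ j, X j ∈ st κ d) :
    -- for a right-stochastic matrix and `κ ≤ 0`, the midpoints are always defined
    (κ ≤ 0 → (∀ i j, 0 ≤ A i j) → ∀ i, MidDefined κ (A i) X) ∧
    -- `A ⊠ X` reduces row-wise to a weighted gyromidpoint, which is a point of the model
    (∀ i, MidDefined κ (A i) X →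
      leftMul κ A X i = gyromidpoint κ (A i) X ∧
      leftMul κ A X i ∈ st κ d) ∧
    -- `A ⊠ ·` commutes with the isometries of `st_κ^d`
    (∀ φ : E d → E d, IsIsom κ φ →
      ∀ i, MidDefined κ (A i) X →
        MidDefined κ (A i) (fun j => φ (X j)) ∧
        leftMul κ A (fun j => φ (X j)) i = φ (leftMul κ A X i)) ∧
    -- `A ⊠ ·` commutes with the (for `κ > 0` only partially defined) motions `x ↦ z ⊕ R x`
    (∀ z ∈ st κ d, ∀ R : E d ≃ₗᵢ[ℝ] E d,
      ∀ i, MidDefined κ (A i) X →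
        (0 < κ → (∀ j, addDen κ z (R (X j)) ≠ 0) ∧
          0 < midDen κ (A i) X *
            midDen κ (A i) (fun j => kAdd κ z (R (X j)))) →
        MidDefined κ (A i) (fun j => kAdd κ z (R (X j))) ∧
        addDen κ z (R (leftMul κ A X i)) ≠ 0 ∧
        leftMul κ A (fun j => kAdd κ z (R (X j))) i =
          kAdd κ z (R (leftMul κ A X i))) ∧
    -- intrinsic: distances between rows of products are unchanged by isometries ...
    (∀ (m : ℕ) (B : Matrix (Fin m) (Fin m) ℝ) (Y : Fin m → E d),
      RowSumsOne B → (∀ k, Y k ∈ st κ d) →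
      ∀ φ : E d → E d, IsIsom κ φ →
      ∀ i k, MidDefined κ (A i) X → MidDefined κ (B k) Y →
        kDist κ (leftMul κ A (fun j => φ (X j)) i)
            (leftMul κ B (fun j => φ (Y j)) k) =
          kDist κ (leftMul κ A X i) (leftMul κ B Y k)) ∧
    -- ... and are determined by the mutual distances of the rows of the arguments
    (∀ (m : ℕ) (B : Matrix (Fin m) (Fin m) ℝ) (Y : Fin m → E d)
      (X' : Fin n → E d) (Y' : Fin m → E d),
      RowSumsOne B → (∀ k, Y k ∈ st κ d) →
      (∀ j, X' j ∈ st κ d) → (∀ k, Y' k ∈ st κ d) →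
      (∀ j l, kDist κ (X' j) (X' l) = kDist κ (X j) (X l)) →
      (∀ j l, kDist κ (Y' j) (Y' l) = kDist κ (Y j) (Y l)) →
      (∀ j l, kDist κ (X' j) (Y' l) = kDist κ (X j) (Y l)) →
      ∀ i k, MidDefined κ (A i) X → MidDefined κ (B k) Y →
        (0 < κ → 0 < midDen κ (A i) X * midDen κ (A i) X' ∧
          0 < midDen κ (B k) Y * midDen κ (B k) Y') →
        MidDefined κ (A i) X' ∧ MidDefined κ (B k) Y' ∧
        kDist κ (leftMul κ A X' i) (leftMul κ B Y' k) =
          kDist κ (leftMul κ A X i)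
            (leftMul κ B Y k)) := by 
  refine ⟨fun hκ hA0 i => midDefined_of_nonpos hκ (hA0 i) (hA i) hX, fun i h => ?_,
    fun φ hφ i h => ?_, fun z hz R i h hs => ?_, fun m B Y hB hY φ hφ i k h hk => ?_,
    fun m B Y X' Y' hB hY hX' hY' hdX hdY hdXY i k h hk hs => ?_⟩
  · rw [leftMul_eq hA h]
    exact ⟨rfl, (gyromidpoint_spec h).1⟩
  · obtain ⟨h1, h2⟩ := gyromidpoint_isom (hA i) hX hφ h
    exact ⟨h1, by rw [leftMul_eq hA h1, leftMul_eq hA h, h2]⟩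
  · obtain ⟨h1, h2, h3⟩ := gyromidpoint_motion hX hz R h hs
    rw [leftMul_eq hA h, leftMul_eq hA h1]
    exact ⟨h1, h2, h3⟩
  · obtain ⟨h1, h2⟩ := gyromidpoint_isom (hA i) hX hφ h
    obtain ⟨k1, k2⟩ := gyromidpoint_isom (hB k) hY hφ hk
    rw [leftMul_eq hA h1, leftMul_eq hA h, leftMul_eq hB k1, leftMul_eq hB hk, h2, k2]
    exact hφ.2 _ (gyromidpoint_spec h).1 _ (gyromidpoint_spec hk).1
  · obtain ⟨h1, k1, hd⟩ := kDist_gyromidpoint_eq (hA i) (hB k) hX hX' hY hY' hdX hdY hdXY h hk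
      (fun hκ => (hs hκ).1) (fun hκ => (hs hκ).2)
    rw [leftMul_eq hA h1, leftMul_eq hA h, leftMul_eq hB k1, leftMul_eq hB hk]
    exact ⟨h1, k1, hd⟩
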